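/- Let $N,p\ge 0$ be integers, and let $(x^{(i)},y^{(i)})\in\mathbb R^p\times\mathbb R$, $i=1,\dots,N$, be data of full rank, in the sense that no proper affine subspace of $\mathbb R^p$ contains all the predictor points $x^{(1)},\dots,x^{(N)}$. Let $$f(\beta_0,\beta)=\tfrac12\sum_{i=1}^N\Big(y^{(i)}-\beta_0-\sum_{j=1}^p\beta_jx^{(i)}_j\Big)^2,\qquad \|\beta\|_1=\sum_{j=1}^p|\beta_j| ,$$ and, with means $\bar x_j=\frac1N\sum_i x^{(i)}_j$, $\bar y=\frac1N\sum_i y^{(i)}$, let $$(K_1)_{jl}=\tfrac1N\sum_{i}(x_j^{(i)}-\bar x_j)(x_l^{(i)}-\bar x_l),\qquad b_j=\tfrac1N\sum_i(x_j^{(i)}-\bar x_j)(y^{(i)}-\bar y),\qquad \hat\beta=K_1^{-1}b,\qquad \hat t=\|\hat\beta\|_1 .$$ A lasso solution for $t\ge0$ is a vector $\beta\in\mathbb R^p$ such that, for some $\beta_0$, $(\beta_0,\beta)$ minimizes $f$ under the constraint $\|\beta\|_1\le t$. A lasso solution with parameter $s$ is a lasso solution $\beta$ for some $t>0$ such that $(K_1\beta-b)_j=s\,\operatorname{sign}(\beta_j)$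 for all $j$ with $\beta_j\neq0$. For nonempty $A\subseteq\{1,\dots,p\}$ the lasso problem induced on the coordinate face $\{\beta:\beta_j=0\text{ for }j\notin A\}$ is the lasso problem that uses only the predictors in $A$; its matrix and vector are the restrictions $K_A$, $b_A$ of $K_1$, $b$, and its center is $K_A^{-1}b_A$ (for $A=\{1,\dots,p\}$ it is the original problem, with center $\hat\beta$). Its rays are the sets $\{K_A^{-1}b_A+sK_A^{-1}\delta: s\le 0\}$ with $\delta\in\{\pm1\}^A$, regarded as subsets of $\mathbb R^p$ by setting the other coordinates to zero. Then $\hat\beta$ is the unique vector of slopes of an unconstrained minimizer of $f$, and there are $\hat s\le0$ and a map $\beta:[\hat s,0]\to\mathbb R^p$ such that the following hold. 1. For every $s\in(\hat s,0]$, $\beta(s)$ is the unique lasso solution with parameter $s$. The function $s\mapsto\|\beta(s)\|_1$ is strictly increasing from $[\hat s,0]$ onto $[0,\hat t]$, and for every $s\in[\hat s,0]$, $\beta(s)$ is the unique lasso solution for $t=\|\beta(s)\|_1$. 2. There are $0=\sigma_0>\sigma_1>\dots>\sigma_m=\hat s$ such that $v_i=\beta(\sigma_i)$ are the vertices of a simple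 polygonal chain (its segments $[v_i,v_{i+1}]$ are nondegenerate, consecutive segments meet only in their common vertex, and non-consecutive segments are disjoint) with $v_0=\hat\beta$ and $v_m=0$, and $\beta([\hat s,0])$ is this chain. (If $\hat\beta=0$, then $m=0$ and the chain is a point.) 3. No two of the segments lie on parallel or equal lines. 4. For every $i<m$ there are a nonempty $A\subseteq\{1,\dots,p\}$ and $\delta\in\{\pm1\}^A$ such that the segment $[v_i,v_{i+1}]$ lies on the ray of the lasso problem induced on the face of $A$ that belongs to $\delta$. Moreover $\beta(s)=K_A^{-1}b_A+sK_A^{-1}\delta$ (extended by zero) for $s\in[\sigma_{i+1},\sigma_i]$, and for $s\in(\sigma_{i+1},\sigma_i)$ the coordinates $\beta_j(s)$, $j\in A$, are nonzero with signs $\delta_j$. -/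

import Mathlib

noncomputable section

namespace Lasso

/-! ### Data, least squares, and the lasso

A data set consists of `N` points: predictors `x i : J → ℝ` and responses `y i : ℝ`.
The predictors are indexed by an arbitrary finite type `J`, so that the same definitions apply
to a problem in `p` predictors and to the problem induced on a subset of the predictors. -/

variable {N : ℕ} {J : Type*} [Fintype J] [DecidableEq J]

/-- The arithmetic mean of `N` numbers. -/
def mean (z : Fin N → ℝ) : ℝ := (∑ i, z i) / N

/-- The covariance matrix `K₁` of the predictors (masses `1 / N`, taken about the centroid). -/
def covMatrix (x : Fin N → J → ℝ) : Matrix J J ℝ :=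
  fun j l => mean fun i => (x i j - mean fun k => x k j) * (x i l - mean fun k => x k l)

/-- The vector `b` of covariances of the predictors with the response. -/
def covVector (x : Fin N → J → ℝ) (y : Fin N → ℝ) : J → ℝ :=
  fun j => mean fun i => (x i j - mean fun k => x k j) * (y i - mean y)

/-- Full rank: the predictor points lie in no affine subspace of smaller dimension. -/
def FullRank (x : Fin N → J → ℝ) : Prop :=
  affineSpan ℝ (Set.range x) = ⊤

/-- The least square objective function, with intercept `β₀`. -/
def objective (x : Fin N → J → ℝ) (y : Fin N → ℝ) (β₀ : ℝ) (β : J → ℝ) : ℝ :=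
  1 / 2 * ∑ i, (y i - β₀ - ∑ j, β j * x i j) ^ 2

/-- The `ℓ¹` norm. -/
def l1 (β : J → ℝ) : ℝ := ∑ j, |β j|

/-- `β` is the vector of slopes of an unconstrained minimizer of the objective function. -/
def IsLeastSquares (x : Fin N → J → ℝ) (y : Fin N → ℝ) (β : J → ℝ) : Prop :=
  ∃ β₀ : ℝ, ∀ (γ₀ : ℝ) (γ : J → ℝ), objective x y β₀ β ≤ objective x y γ₀ γ

/-- `β` is the vector of slopes of a minimizer of the objective function under the constraint
`‖β‖₁ ≤ t`; the intercept is not constrained. -/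
def IsLassoSolution (x : Fin N → J → ℝ) (y : Fin N → ℝ) (t : ℝ) (β : J → ℝ) : Prop :=
  l1 β ≤ t ∧ ∃ β₀ : ℝ, ∀ (γ₀ : ℝ) (γ : J → ℝ), l1 γ ≤ t →
    objective x y β₀ β ≤ objective x y γ₀ γ

/-- `β` is the lasso solution with parameter `s`: it is a lasso solution for some `t > 0`, and the
gradient `K₁ β - b` of the equimomental ellipsoid, projected to the coordinates on which `β` does
not vanish, is `s` times the vector of signs of `β`. -/
def IsLassoSolutionAt (x : Fin N → J → ℝ) (y : Fin N → ℝ) (s : ℝ) (β : J → ℝ) : Prop :=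
  (∃ t : ℝ, 0 < t ∧ IsLassoSolution x y t β) ∧
    ∀ j, β j ≠ 0 →
      ((covMatrix x).mulVec β - covVector x y) j = s * Real.sign (β j)

/-- The common center `β̂ = K₁⁻¹ b` of the equimomental ellipsoids. -/
def center (x : Fin N → J → ℝ) (y : Fin N → ℝ) : J → ℝ :=
  (covMatrix x)⁻¹.mulVec (covVector x y)

/-- The point with parameter `s` on the line through the center with direction `K₁⁻¹ δ`. -/
def rayPoint (x : Fin N → J → ℝ) (y : Fin N → ℝ) (δ : J → ℝ) (s : ℝ) : J → ℝ :=
  center x y + s • (covMatrix x)⁻¹.mulVec δ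

/-- The ray of the lasso problem `(x, y)` that belongs to the sign vector `δ`. It starts at the
center and consists of the points `β` with `K₁ β - b = s δ` for some `s ≤ 0`. -/
def ray (x : Fin N → J → ℝ) (y : Fin N → ℝ) (δ : J → ℝ) : Set (J → ℝ) :=
  rayPoint x y δ '' Set.Iic 0

/-- The predictors of the lasso problem induced on the coordinate face
`{β | ∀ j ∉ A, β j = 0}`. Its covariance matrix is obtained from `K₁` by omitting the rows and
columns outside `A`; for `A = Finset.univ` it is the original problem. -/
def induced (x : Fin N → J → ℝ) (A : Finset J) : Fin N → A → ℝ :=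
  fun i j => x i j

/-- The inclusion of a coordinate face: extension by zero. -/
def extendZero (A : Finset J) (u : A → ℝ) : J → ℝ :=
  fun j => if h : j ∈ A then u ⟨j, h⟩ else 0

end Lasso

/-! ### Polygonal chains -/

namespace PolygonalChain

variable {E : Type*} [AddCommGroup E] [Module ℝ E] {m : ℕ}

/-- The `i`-th segment of the polygonal chain with vertices `v 0, …, v m`. -/
def edge (v : Fin (m + 1) → E) (i : Fin m) : Set E :=
  segment ℝ (v i.castSucc) (v i.succ)

/-- The set of points of a polygonal chain (a single point if there are no segments). -/
def trace (v : Fin (m + 1) → E) : Set E :=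
  Set.range v ∪ ⋃ i, edge v i

/-- A simple polygonal chain: segments are nondegenerate, consecutive segments meet only in their
common vertex, and other segments do not meet. -/
structure IsSimple (v : Fin (m + 1) → E) : Prop where
  nondegenerate : ∀ i : Fin m, v i.castSucc ≠ v i.succ
  consecutive : ∀ i j : Fin m, (j : ℕ) = i + 1 → edge v i ∩ edge v j = {v i.succ}
  disjoint : ∀ i j : Fin m, (i : ℕ) + 1 < j → Disjoint (edge v i) (edge v j)

/-- No two segments lie on parallel (or equal) lines. -/
def NoParallel (v : Fin (m + 1) → E) : Prop :=
  ∀ i j : Fin m, i ≠ j →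
    ¬ (affineSpan ℝ {v i.castSucc, v i.succ}).Parallel (affineSpan ℝ {v j.castSucc, v j.succ})

end PolygonalChain

end

/-!
For a positive definite matrix `K` and `s ≤ 0`, the Karush-Kuhn-Tucker conditions of the convex
function `β ↦ ½ βᵀ K β - bᵀ β - s ‖β‖₁` have a unique solution `β(s)`, and `β(s)` is the lasso
solution for `t = ‖β(s)‖₁`. The conditions are monotone: solutions `β`, `γ` with parameters `s`, `t`
satisfy `(γ - β)ᵀ K (γ - β) ≤ (t - s) (‖γ‖₁ - ‖β‖₁)`. Hence `‖β(s)‖₁` is strictly increasing from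
the parameter `-‖b‖_∞`, where the path leaves `0`, to the parameter `0` of the least squares
point.

For a fixed sign vector `τ` the conditions are linear, and jointly convex in `(s, β)`. So the
parameters at which `β(s)` has sign vector `τ` form an interval, on which `β(s)` is affine with
direction `d`, where `d` is supported on the support `A` of `τ` and `K d = τ` on `A`. As there are
finitely many sign vectors, the path is a polygonal chain whose segments have distinct sign vectors.

Parallel segments have proportional directions. Since `K d` has entries `±1` on `A`, the factor is
`1` or `-1`, and `-1` is impossible because `‖β(s)‖₁ = dᵀ b + s dᵀ K d` is positive on both segments
while `s ≤ 0`. For equal directions, `‖γ‖₁ - ‖β‖₁ = (t - s) dᵀ K d = (γ - β)ᵀ K d`, so the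
monotonicity inequality is the reverse Cauchy-Schwarz inequality and `γ - β` is a multiple of `d`.
The two points then agree where `d` vanishes and have the signs of `K d` where it does not, so their
sign vectors are equal.
-/

noncomputable section

namespace PolygonalChain

open Set

section OrderedKnots

variable {α : Type*} [LinearOrder α] {m : ℕ} {σ : Fin (m + 1) → α}

lemma exists_strictAnti_range_eq {B : Set α} (hB : B.Finite) {a c : α} (ha : IsLeast B a)
    (hc : IsGreatest B c) :
    ∃ (m : ℕ) (σ : Fin (m + 1) → α),
      StrictAnti σ ∧ range σ = B ∧ σ 0 = c ∧ σ (Fin.last m) = a := by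
  obtain ⟨m, hm⟩ : ∃ m, hB.toFinset.card = m + 1 :=
    Nat.exists_eq_succ_of_ne_zero (Finset.card_ne_zero_of_mem (hB.mem_toFinset.2 ha.1))
  let σ : Fin (m + 1) → α := hB.toFinset.orderEmbOfFin hm ∘ Fin.rev
  have hσ : StrictAnti σ := (OrderEmbedding.strictMono _).comp_strictAnti Fin.rev_strictAnti
  have hrange : range σ = B := by
    rw [range_comp, Fin.rev_surjective.range_eq, image_univ, Finset.range_orderEmbOfFin,
      hB.coe_toFinset]
  have hgreatest : IsGreatest (range σ) (σ 0) :=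
    ⟨mem_range_self 0, forall_mem_range.2 fun k => hσ.antitone (Fin.zero_le k)⟩
  have hleast : IsLeast (range σ) (σ (Fin.last m)) :=
    ⟨mem_range_self _, forall_mem_range.2 fun k => hσ.antitone (Fin.le_last k)⟩
  exact ⟨m, σ, hσ, hrange, (hrange ▸ hgreatest).unique hc, (hrange ▸ hleast).unique ha⟩

lemma Icc_subset_Icc_of_antitone (hσ : Antitone σ) (i : Fin m) :
    Icc (σ i.succ) (σ i.castSucc) ⊆ Icc (σ (Fin.last m)) (σ 0) :=
  Icc_subset_Icc (hσ (Fin.le_last _)) (hσ (Fin.zero_le _))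

lemma disjoint_Ioo_range_of_strictAnti (hσ : StrictAnti σ) (i : Fin m) :
    Disjoint (Ioo (σ i.succ) (σ i.castSucc)) (range σ) := by
  rw [disjoint_left]
  rintro _ ⟨hlt, hgt⟩ ⟨k, rfl⟩
  rw [hσ.lt_iff_gt, Fin.lt_def] at hlt hgt
  simp only [Fin.val_succ, Fin.val_castSucc] at hlt hgt
  lia

lemma mem_range_or_exists_mem_Icc {s : α} (hs : s ∈ Icc (σ (Fin.last m)) (σ 0)) :
    s ∈ range σ ∨ ∃ i : Fin m, s ∈ Icc (σ i.succ) (σ i.castSucc) := by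
  have of_le : ∀ k : Fin (m + 1), σ k ≤ s →
      s ∈ range σ ∨ ∃ i : Fin m, s ∈ Icc (σ i.succ) (σ i.castSucc) := by
    intro k
    induction k using Fin.induction with
    | zero => exact fun h => Or.inl ⟨0, le_antisymm h hs.2⟩
    | succ i ih =>
      intro h
      rcases le_total (σ i.castSucc) s with hi | hi
      · exact ih hi
      · exact Or.inr ⟨i, h, hi⟩
  exact of_le _ hs.1

end OrderedKnots

section PiecewiseConstant

variable {α T : Type*} [ConditionallyCompleteLinearOrder α] [TopologicalSpace α] [OrderTopology α]
  {f : α → T} {a c : α}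

lemma diff_interior_subset_of_ordConnected {S : Set α} (hS : S.OrdConnected) (hb : BddBelow S)
    (ha : BddAbove S) : S \ interior S ⊆ {sInf S, sSup S} := by
  rintro s ⟨hs, hi⟩
  by_contra! hne
  rw [mem_insert_iff, mem_singleton_iff, not_or] at hne
  obtain ⟨u, hu, hus⟩ := exists_lt_of_csInf_lt ⟨s, hs⟩ ((csInf_le hb hs).lt_of_ne' hne.1)
  obtain ⟨v, hv, hsv⟩ := exists_lt_of_lt_csSup ⟨s, hs⟩ ((le_csSup ha hs).lt_of_ne hne.2)
  exact hi (mem_interior.2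
    ⟨Ioo u v, Ioo_subset_Icc_self.trans (hS.out hu hv), isOpen_Ioo, hus, hsv⟩)

/-- The points of `[a, c]` near which `f`, restricted to `[a, c]`, is not constant. The end points
count as breakpoints, since no neighbourhood of them lies in `[a, c]`. -/
def breakpoints (f : α → T) (a c : α) : Set α :=
  Icc a c \ ⋃ τ, interior (Icc a c ∩ f ⁻¹' {τ})

lemma finite_breakpoints [Finite T] (hf : ∀ τ, (Icc a c ∩ f ⁻¹' {τ}).OrdConnected) :
    (breakpoints f a c).Finite := by
  refine (finite_iUnion fun τ => toFinite
    {sInf (Icc a c ∩ f ⁻¹' {τ}), sSup (Icc a c ∩ f ⁻¹' {τ})}).subset fun s hs => ?_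
  exact mem_iUnion.2 ⟨f s, diff_interior_subset_of_ordConnected (hf _)
    (bddBelow_Icc.mono inter_subset_left) (bddAbove_Icc.mono inter_subset_left)
    ⟨⟨hs.1, rfl⟩, fun h => hs.2 (mem_iUnion.2 ⟨_, h⟩)⟩⟩

lemma isLeast_breakpoints [NoMinOrder α] [NoMaxOrder α] [DenselyOrdered α] (f : α → T)
    (hac : a ≤ c) : IsLeast (breakpoints f a c) a := by
  refine ⟨⟨left_mem_Icc.2 hac, fun h => ?_⟩, fun _ hs => hs.1.1⟩
  obtain ⟨τ, hτ⟩ := mem_iUnion.1 h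
  exact (interior_Icc.subset (interior_mono inter_subset_left hτ)).1.false

lemma isGreatest_breakpoints [NoMinOrder α] [NoMaxOrder α] [DenselyOrdered α] (f : α → T)
    (hac : a ≤ c) : IsGreatest (breakpoints f a c) c := by
  refine ⟨⟨right_mem_Icc.2 hac, fun h => ?_⟩, fun _ hs => hs.1.2⟩
  obtain ⟨τ, hτ⟩ := mem_iUnion.1 h
  exact (interior_Icc.subset (interior_mono inter_subset_left hτ)).2.false

lemma exists_eqOn_const_of_disjoint_breakpoints [DenselyOrdered α] {s t : α} (hst : s < t)
    (hsub : Ioo s t ⊆ Icc a c) (hd : Disjoint (Ioo s t) (breakpoints f a c)) :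
    ∃ τ, ∀ r ∈ Ioo s t, f r = τ := by
  let _ : TopologicalSpace T := ⊥
  have : DiscreteTopology T := ⟨rfl⟩
  have hcont : ContinuousOn f (Ioo s t) := fun r hr => by
    obtain ⟨τ, hτ⟩ : ∃ τ, r ∈ interior (Icc a c ∩ f ⁻¹' {τ}) := by
      by_contra hc
      exact disjoint_left.1 hd hr ⟨hsub hr, fun h => hc (mem_iUnion.1 h)⟩
    have hev : f =ᶠ[nhds r] fun _ => τ := by
      filter_upwards [mem_interior_iff_mem_nhds.1 hτ] with u hu using hu.2
    exact (continuousAt_const.congr hev.symm).continuousWithinAt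
  obtain ⟨r, hr⟩ := nonempty_Ioo.2 hst
  exact ⟨f r, fun u hu => isPreconnected_Ioo.constant hcont hu hr⟩

lemma ne_of_mem_breakpoints (hf : ∀ τ, (Icc a c ∩ f ⁻¹' {τ}).OrdConnected) {r s t : α}
    (hr : r ∈ breakpoints f a c) (hs : s ∈ Icc a c) (ht : t ∈ Icc a c) (hsr : s < r)
    (hrt : r < t) : f s ≠ f t := fun h =>
  hr.2 (mem_iUnion.2 ⟨f t, mem_interior.2 ⟨Ioo s t, Ioo_subset_Icc_self.trans
    ((hf _).out ⟨hs, h⟩ ⟨ht, rfl⟩), isOpen_Ioo, hsr, hrt⟩⟩)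

theorem exists_strictAnti_injective_const_on_Ioo [Finite T] [DenselyOrdered α] [NoMinOrder α]
    [NoMaxOrder α] (hac : a ≤ c) (hf : ∀ τ, (Icc a c ∩ f ⁻¹' {τ}).OrdConnected) :
    ∃ (m : ℕ) (σ : Fin (m + 1) → α) (τ : Fin m → T), StrictAnti σ ∧ σ 0 = c ∧ σ (Fin.last m) = a ∧
      Function.Injective τ ∧ ∀ i, ∀ s ∈ Ioo (σ i.succ) (σ i.castSucc), f s = τ i := by
  obtain ⟨m, σ, hσ, hrange, hσ0, hσm⟩ := exists_strictAnti_range_eq (finite_breakpoints hf)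
    (isLeast_breakpoints f hac) (isGreatest_breakpoints f hac)
  have hlt (i : Fin m) : σ i.succ < σ i.castSucc := hσ i.castSucc_lt_succ
  have hsub (i : Fin m) : Ioo (σ i.succ) (σ i.castSucc) ⊆ Icc a c :=
    hσ0 ▸ hσm ▸ Ioo_subset_Icc_self.trans (Icc_subset_Icc_of_antitone hσ.antitone i)
  choose τ hτ using fun i => exists_eqOn_const_of_disjoint_breakpoints (f := f) (hlt i) (hsub i)
    (hrange ▸ disjoint_Ioo_range_of_strictAnti hσ i)
  choose r hr using fun i => nonempty_Ioo.2 (hlt i)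
  have hne : ∀ i j : Fin m, i < j → τ i ≠ τ j := fun i j hij => by
    rw [← hτ i _ (hr i), ← hτ j _ (hr j)]
    exact (ne_of_mem_breakpoints hf (hrange ▸ mem_range_self i.succ) (hsub j (hr j)) (hsub i (hr i))
      ((hr j).2.trans_le (hσ.antitone (Fin.succ_le_castSucc_iff.2 hij))) (hr i).1).symm
  refine ⟨m, σ, τ, hσ, hσ0, hσm, fun i j hij => ?_, hτ⟩
  by_contra! h
  exact h.lt_or_gt.elim (fun h => hne i j h hij) (fun h => hne j i h hij.symm)

end PiecewiseConstant

section PiecewiseAffine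

variable {E : Type*} [AddCommGroup E] [Module ℝ E] {m : ℕ} {σ : Fin (m + 1) → ℝ} {f : ℝ → E}
  {e d : Fin m → E}

/-- The curve `f` runs through the vertices `f (σ 0), …, f (σ m)` of a polygonal chain at the
decreasing parameters `σ`, and its `i`-th piece is `s ↦ e i + s • d i`. -/
structure IsPiecewiseAffine (σ : Fin (m + 1) → ℝ) (f : ℝ → E) (e d : Fin m → E) : Prop where
  strictAnti : StrictAnti σ
  eqOn : ∀ i, EqOn f (fun s => e i + s • d i) (Icc (σ i.succ) (σ i.castSucc))

namespace IsPiecewiseAffine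

lemma lt (h : IsPiecewiseAffine σ f e d) (i : Fin m) : σ i.succ < σ i.castSucc :=
  h.strictAnti i.castSucc_lt_succ

lemma edge_eq_image (h : IsPiecewiseAffine σ f e d) (i : Fin m) :
    edge (f ∘ σ) i = f '' Icc (σ i.succ) (σ i.castSucc) := by
  let g : ℝ →ᵃ[ℝ] E := AffineMap.lineMap (e i) (e i + d i)
  have hfg : EqOn f g (Icc (σ i.succ) (σ i.castSucc)) := fun s hs => by
    simp [g, h.eqOn i hs, AffineMap.lineMap_apply, add_comm]
  rw [hfg.image_eq, ← segment_eq_Icc (h.lt i).le, segment_symm, image_segment, edge,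
    Function.comp_apply, Function.comp_apply, hfg (right_mem_Icc.2 (h.lt i).le),
    hfg (left_mem_Icc.2 (h.lt i).le)]

lemma image_Icc_eq_trace (h : IsPiecewiseAffine σ f e d) :
    f '' Icc (σ (Fin.last m)) (σ 0) = trace (f ∘ σ) := by
  simp only [trace, h.edge_eq_image]
  apply Subset.antisymm
  · rintro _ ⟨s, hs, rfl⟩
    rcases mem_range_or_exists_mem_Icc hs with ⟨k, rfl⟩ | ⟨i, hi⟩
    · exact Or.inl ⟨k, rfl⟩
    · exact Or.inr (mem_iUnion.2 ⟨i, mem_image_of_mem f hi⟩)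
  · refine union_subset (range_subset_iff.2 fun k => mem_image_of_mem f ?_)
      (iUnion_subset fun i => image_mono (Icc_subset_Icc_of_antitone h.strictAnti.antitone i))
    exact ⟨h.strictAnti.antitone (Fin.le_last _), h.strictAnti.antitone (Fin.zero_le _)⟩

lemma isSimple (h : IsPiecewiseAffine σ f e d)
    (hinj : InjOn f (Icc (σ (Fin.last m)) (σ 0))) : IsSimple (f ∘ σ) := by
  have hsub (i : Fin m) := Icc_subset_Icc_of_antitone h.strictAnti.antitone i
  have edge_inter_edge (i j : Fin m) : edge (f ∘ σ) i ∩ edge (f ∘ σ) j =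
      f '' (Icc (σ i.succ) (σ i.castSucc) ∩ Icc (σ j.succ) (σ j.castSucc)) := by
    rw [h.edge_eq_image, h.edge_eq_image, hinj.image_inter (hsub i) (hsub j)]
  refine ⟨fun i hi => ?_, fun i j hij => ?_, fun i j hij => ?_⟩
  · exact (h.lt i).ne' (hinj (hsub i (right_mem_Icc.2 (h.lt i).le))
      (hsub i (left_mem_Icc.2 (h.lt i).le)) hi)
  · have hji : j.castSucc = i.succ := by ext; simpa using hij
    rw [edge_inter_edge, inter_comm, hji, Icc_inter_Icc_eq_singleton (hji ▸ h.lt j).le (h.lt i).le,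
      image_singleton, Function.comp_apply]
  · have hji : σ j.castSucc < σ i.succ := h.strictAnti (by simpa [Fin.lt_def] using hij)
    rw [disjoint_iff_inter_eq_empty, edge_inter_edge, image_eq_empty, ← disjoint_iff_inter_eq_empty]
    exact disjoint_left.2 fun s hi hj => (hj.2.trans_lt hji).not_ge hi.1

lemma exists_eq_smul_of_parallel (h : IsPiecewiseAffine σ f e d) {i j : Fin m}
    (hpar : (affineSpan ℝ {(f ∘ σ) i.castSucc, (f ∘ σ) i.succ}).Parallel
      (affineSpan ℝ {(f ∘ σ) j.castSucc, (f ∘ σ) j.succ})) : ∃ c : ℝ, d j = c • d i := by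
  have vsub_eq (k : Fin m) :
      (f ∘ σ) k.castSucc -ᵥ (f ∘ σ) k.succ = (σ k.castSucc - σ k.succ) • d k := by
    rw [vsub_eq_sub, Function.comp_apply, Function.comp_apply,
      h.eqOn k (right_mem_Icc.2 (h.lt k).le), h.eqOn k (left_mem_Icc.2 (h.lt k).le)]
    module
  have hdir := hpar.direction_eq
  rw [direction_affineSpan, direction_affineSpan] at hdir
  have hmem : (f ∘ σ) j.castSucc -ᵥ (f ∘ σ) j.succ ∈
      vectorSpan ℝ {(f ∘ σ) i.castSucc, (f ∘ σ) i.succ} :=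
    hdir ▸ mem_vectorSpan_pair.2 ⟨1, one_smul _ _⟩
  obtain ⟨r, hr⟩ := mem_vectorSpan_pair.1 hmem
  rw [vsub_eq, vsub_eq] at hr
  refine ⟨(σ j.castSucc - σ j.succ)⁻¹ * (r * (σ i.castSucc - σ i.succ)), ?_⟩
  rw [mul_smul, mul_smul, hr, inv_smul_smul₀ (sub_pos.2 (h.lt j)).ne']

end IsPiecewiseAffine

end PiecewiseAffine

end PolygonalChain

namespace Lasso

open Matrix

section L1

variable {J : Type*} [Fintype J]

lemma l1_eq_norm (β : J → ℝ) : l1 β = ‖WithLp.toLp 1 β‖ := by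
  simp [l1, PiLp.norm_eq_of_L1]

lemma l1_nonneg (β : J → ℝ) : 0 ≤ l1 β := l1_eq_norm β ▸ norm_nonneg _

lemma l1_zero : l1 (0 : J → ℝ) = 0 := by simp [l1]

lemma l1_pos {β : J → ℝ} : 0 < l1 β ↔ β ≠ 0 := by
  simp [l1_eq_norm]

lemma l1_add_le (β γ : J → ℝ) : l1 (β + γ) ≤ l1 β + l1 γ := by
  simpa [l1_eq_norm] using norm_add_le (WithLp.toLp 1 β) (WithLp.toLp 1 γ)

lemma l1_single [DecidableEq J] (j : J) (c : ℝ) : l1 (Pi.single j c) = |c| := by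
  rw [l1, Finset.sum_eq_single j] <;> simp +contextual

lemma continuous_l1 : Continuous (l1 : (J → ℝ) → ℝ) :=
  continuous_finsetSum Finset.univ fun j _ => (continuous_apply j).abs

lemma convexOn_l1 : ConvexOn ℝ Set.univ (l1 : (J → ℝ) → ℝ) := by
  have hcomp := (convexOn_univ_norm (E := PiLp 1 fun _ : J => ℝ)).comp_linearMap
    (WithLp.linearEquiv 1 ℝ (J → ℝ)).symm.toLinearMap
  exact hcomp.congr fun β _ => (l1_eq_norm β).symm

lemma norm_le_l1 (β : J → ℝ) : ‖β‖ ≤ l1 β :=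
  (pi_norm_le_iff_of_nonneg (l1_nonneg β)).2 fun j =>
    Finset.single_le_sum (f := fun j => |β j|) (fun _ _ => abs_nonneg _) (Finset.mem_univ j)

lemma isCompact_setOf_l1_le (r : ℝ) : IsCompact {β : J → ℝ | l1 β ≤ r} :=
  (isCompact_closedBall 0 r).of_isClosed_subset (isClosed_le continuous_l1 continuous_const)
    fun β hβ => mem_closedBall_zero_iff.2 ((norm_le_l1 β).trans hβ)

end L1

section Quadratic

variable {J : Type*} [Fintype J] {K : Matrix J J ℝ}

lemma dotProduct_mulVec_comm (hK : K.IsSymm) (v w : J → ℝ) : v ⬝ᵥ K *ᵥ w = w ⬝ᵥ K *ᵥ v := by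
  rw [dotProduct_mulVec, ← mulVec_transpose, hK.eq, dotProduct_comm]

lemma dotProduct_mulVec_nonneg (hK : K.PosSemidef) (v : J → ℝ) : 0 ≤ v ⬝ᵥ K *ᵥ v := by
  simpa using hK.dotProduct_mulVec_nonneg v

lemma eq_zero_of_dotProduct_mulVec_nonpos (hK : K.PosDef) {v : J → ℝ}
    (hv : v ⬝ᵥ K *ᵥ v ≤ 0) : v = 0 := by
  by_contra h
  exact hv.not_gt (by simpa using hK.dotProduct_mulVec_pos h)

/-- The quadratic function with Hessian `K` and gradient `K β - b`. Up to constants it is the part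
of the least square objective function that depends on the slopes. -/
def quad (K : Matrix J J ℝ) (b β : J → ℝ) : ℝ := 1 / 2 * (β ⬝ᵥ K *ᵥ β) - b ⬝ᵥ β

lemma continuous_quad (K : Matrix J J ℝ) (b : J → ℝ) : Continuous (quad K b) := by
  unfold quad; fun_prop

lemma quad_sub (hK : K.IsSymm) (b β γ : J → ℝ) :
    quad K b γ - quad K b β =
      (K *ᵥ β - b) ⬝ᵥ (γ - β) + 1 / 2 * ((γ - β) ⬝ᵥ K *ᵥ (γ - β)) := by
  have hcomm := dotProduct_mulVec_comm hK β γ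
  simp only [quad, mulVec_sub, dotProduct_sub, sub_dotProduct, dotProduct_comm (K *ᵥ β)]
  linarith

lemma dotProduct_mulVec_sub_smul (hK : K.IsSymm) (β γ : J → ℝ) (c : ℝ) :
    (β - c • γ) ⬝ᵥ K *ᵥ (β - c • γ) =
      β ⬝ᵥ K *ᵥ β - 2 * c * (β ⬝ᵥ K *ᵥ γ) + c ^ 2 * (γ ⬝ᵥ K *ᵥ γ) := by
  have hcomm := dotProduct_mulVec_comm hK β γ
  simp only [mulVec_sub, mulVec_smul, dotProduct_sub, sub_dotProduct, dotProduct_smul,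
    smul_dotProduct, smul_eq_mul]
  linear_combination c * hcomm

end Quadratic

section KKT

variable {J : Type*} [Fintype J] {K : Matrix J J ℝ} {b β γ : J → ℝ} {s t : ℝ}

/-- The Karush-Kuhn-Tucker conditions for `β` to minimize `quad K b` under a bound on the `ℓ¹` norm.
The parameter `s` is the negative of the multiplier, so that the gradient `K β - b` equals `s` times
the signs of `β` on the support of `β`. -/
structure IsKKTPoint (K : Matrix J J ℝ) (b : J → ℝ) (s : ℝ) (β : J → ℝ) : Prop where
  abs_le : ∀ j, |(K *ᵥ β - b) j| ≤ -s
  mul_eq : ∀ j, (K *ᵥ β - b) j * β j = s * |β j|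

lemma isKKTPoint_of_mulVec_eq (h : K *ᵥ β = b) : IsKKTPoint K b 0 β :=
  ⟨fun j => by simp [h], fun j => by simp [h]⟩

lemma isKKTPoint_zero_iff (hs : s ≤ 0) : IsKKTPoint K b s 0 ↔ s ≤ -‖b‖ := by
  have hnorm : s ≤ -‖b‖ ↔ ∀ j, |b j| ≤ -s := by
    rw [le_neg, pi_norm_le_iff_of_nonneg (neg_nonneg.2 hs)]
    rfl
  rw [hnorm]
  exact ⟨fun h j => by simpa using h.abs_le j, fun h => ⟨fun j => by simpa using h j, by simp⟩⟩

lemma isKKTPoint_of_tendsto {ι : Type*} {l : Filter ι} [l.NeBot] {σ : ι → ℝ} {φ : ι → J → ℝ}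
    (hσ : Filter.Tendsto σ l (nhds s)) (hφ : Filter.Tendsto φ l (nhds β))
    (h : ∀ᶠ i in l, IsKKTPoint K b (σ i) (φ i)) : IsKKTPoint K b s β := by
  have hφj (j : J) : Filter.Tendsto (fun i => φ i j) l (nhds (β j)) :=
    ((continuous_apply j).tendsto β).comp hφ
  have hgrad (j : J) : Filter.Tendsto (fun i => (K *ᵥ φ i - b) j) l (nhds ((K *ᵥ β - b) j)) :=
    ((show Continuous fun γ => (K *ᵥ γ - b) j by fun_prop).tendsto β).comp hφ
  exact ⟨fun j => le_of_tendsto_of_tendsto (hgrad j).abs hσ.neg (h.mono fun _ hi => hi.abs_le j),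
    fun j => tendsto_nhds_unique_of_eventuallyEq ((hgrad j).mul (hφj j)) (hσ.mul (hφj j).abs)
      (h.mono fun _ hi => hi.mul_eq j)⟩

namespace IsKKTPoint

lemma dotProduct_self (h : IsKKTPoint K b s β) : (K *ᵥ β - b) ⬝ᵥ β = s * l1 β := by
  simp only [dotProduct, l1, Finset.mul_sum, h.mul_eq]

lemma mul_abs_le (h : IsKKTPoint K b s β) (j : J) (c : ℝ) : s * |c| ≤ (K *ᵥ β - b) j * c := by
  have hmul := mul_le_mul_of_nonneg_right (h.abs_le j) (abs_nonneg c)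
  rw [← abs_mul] at hmul
  linarith [neg_abs_le ((K *ᵥ β - b) j * c)]

lemma mul_l1_le_dotProduct (h : IsKKTPoint K b s β) (γ : J → ℝ) :
    s * l1 γ ≤ (K *ᵥ β - b) ⬝ᵥ γ := by
  simp only [dotProduct, l1, Finset.mul_sum]
  exact Finset.sum_le_sum fun j _ => h.mul_abs_le j (γ j)

lemma gradient_eq (h : IsKKTPoint K b s β) {j : J} (hj : β j ≠ 0) :
    (K *ᵥ β - b) j = s * SignType.sign (β j) := by
  have hmul := h.mul_eq j
  rw [← sign_mul_self (β j), ← mul_assoc] at hmul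
  exact mul_right_cancel₀ hj hmul

lemma param_eq_of_gradient_eq (h : IsKKTPoint K b s β) (hβ : β ≠ 0)
    (hgrad : ∀ j, β j ≠ 0 → (K *ᵥ β - b) j = t * SignType.sign (β j)) : s = t := by
  obtain ⟨j, hj⟩ := Function.ne_iff.1 hβ
  have hmul := h.mul_eq j
  rw [hgrad j hj, mul_assoc, sign_mul_self] at hmul
  exact (mul_right_cancel₀ (abs_ne_zero.2 hj) hmul).symm

lemma dotProduct_mulVec_le (h : IsKKTPoint K b s β) (h' : IsKKTPoint K b t γ) :
    (γ - β) ⬝ᵥ K *ᵥ (γ - β) ≤ (t - s) * (l1 γ - l1 β) := by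
  have hexpand : (γ - β) ⬝ᵥ K *ᵥ (γ - β) = (K *ᵥ γ - b) ⬝ᵥ γ - (K *ᵥ γ - b) ⬝ᵥ β
      - (K *ᵥ β - b) ⬝ᵥ γ + (K *ᵥ β - b) ⬝ᵥ β := by
    rw [dotProduct_comm]
    simp only [mulVec_sub, dotProduct_sub, sub_dotProduct]
    ring
  rw [hexpand, h.dotProduct_self, h'.dotProduct_self]
  linarith [h.mul_l1_le_dotProduct γ, h'.mul_l1_le_dotProduct β]

lemma unique (hK : K.PosDef) (h : IsKKTPoint K b s β) (h' : IsKKTPoint K b s γ) : γ = β :=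
  sub_eq_zero.1 (eq_zero_of_dotProduct_mulVec_nonpos hK (by simpa using h.dotProduct_mulVec_le h'))

lemma quad_sub_mul_l1_add_le (hK : K.IsSymm) (h : IsKKTPoint K b s β) (γ : J → ℝ) :
    quad K b β - s * l1 β + 1 / 2 * ((γ - β) ⬝ᵥ K *ᵥ (γ - β)) ≤ quad K b γ - s * l1 γ := by
  have hsub := quad_sub hK b β γ
  rw [dotProduct_sub, h.dotProduct_self] at hsub
  linarith [h.mul_l1_le_dotProduct γ]

lemma quad_le (hK : K.PosSemidef) (h : IsKKTPoint K b s β) (hγ : s * l1 β ≤ s * l1 γ) :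
    quad K b β ≤ quad K b γ := by
  linarith [h.quad_sub_mul_l1_add_le (isHermitian_iff_isSymm.1 hK.isHermitian) γ,
    dotProduct_mulVec_nonneg hK (γ - β)]

lemma eq_of_quad_le (hK : K.PosDef) (h : IsKKTPoint K b s β) (hγ : s * l1 β ≤ s * l1 γ)
    (hle : quad K b γ ≤ quad K b β) : γ = β := by
  have hadd := h.quad_sub_mul_l1_add_le (isHermitian_iff_isSymm.1 hK.isHermitian) γ
  exact sub_eq_zero.1 (eq_zero_of_dotProduct_mulVec_nonpos hK (by linarith))

lemma l1_le_l1 (hK : K.PosSemidef) (h : IsKKTPoint K b s β) (h' : IsKKTPoint K b t γ)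
    (hst : s < t) : l1 β ≤ l1 γ :=
  sub_nonneg.1 (nonneg_of_mul_nonneg_right
    ((dotProduct_mulVec_nonneg hK _).trans (h.dotProduct_mulVec_le h')) (sub_pos.2 hst))

lemma l1_lt_l1 (hK : K.PosDef) (h : IsKKTPoint K b s β) (h' : IsKKTPoint K b t γ) (hγ : γ ≠ 0)
    (hst : s < t) : l1 β < l1 γ := by
  refine (h.l1_le_l1 hK.posSemidef h' hst).lt_of_ne fun hl => ?_
  have hle := h.dotProduct_mulVec_le h'
  rw [hl, sub_self, mul_zero] at hle
  obtain rfl : γ = β := sub_eq_zero.1 (eq_zero_of_dotProduct_mulVec_nonpos hK hle)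
  exact hst.ne (h.param_eq_of_gradient_eq hγ fun _ => h'.gradient_eq)

end IsKKTPoint

lemma isKKTPoint_of_forall_mul_abs_le (hmul : ∀ j c, s * |c| ≤ (K *ᵥ β - b) j * c)
    (hself : (K *ᵥ β - b) ⬝ᵥ β ≤ s * l1 β) : IsKKTPoint K b s β := by
  refine ⟨fun j => ?_, fun j => ?_⟩
  · have hone := hmul j 1
    have hneg := hmul j (-1)
    simp only [abs_neg, abs_one] at hone hneg
    exact abs_le.2 ⟨by linarith, by linarith⟩
  · have hle : ∀ j ∈ Finset.univ, s * |β j| ≤ (K *ᵥ β - b) j * β j := fun j _ => hmul j (β j)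
    have hsum : ∑ j, s * |β j| = ∑ j, (K *ᵥ β - b) j * β j :=
      (Finset.sum_le_sum hle).antisymm (by rwa [← Finset.mul_sum])
    exact ((Finset.sum_eq_sum_iff_of_le hle).1 hsum j (Finset.mem_univ j)).symm

lemma isKKTPoint_of_forall (hs : s ≤ 0)
    (h : ∀ γ, s * (l1 γ - l1 β) ≤ (K *ᵥ β - b) ⬝ᵥ (γ - β)) : IsKKTPoint K b s β := by
  classical
  refine isKKTPoint_of_forall_mul_abs_le (fun j c => ?_) ?_
  · have hj := h (β + Pi.single j c)
    have hle := l1_add_le β (Pi.single j c)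
    rw [l1_single] at hle
    rw [add_sub_cancel_left, dotProduct_single] at hj
    refine le_trans ?_ hj
    exact mul_le_mul_of_nonpos_left (by linarith) hs
  · have hzero := h 0
    rw [l1_zero, zero_sub, zero_sub, dotProduct_neg] at hzero
    linarith

lemma isKKTPoint_of_forall_le (hK : K.IsSymm) (hs : s ≤ 0)
    (h : ∀ γ, quad K b β - s * l1 β ≤ quad K b γ - s * l1 γ) : IsKKTPoint K b s β := by
  -- First order condition along the segment from `β` to `γ`, on which `l1` is below its chord.
  refine isKKTPoint_of_forall hs fun γ => ?_
  set q := 1 / 2 * ((γ - β) ⬝ᵥ K *ᵥ (γ - β)) with hq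
  have hpos : ∀ ε ∈ Set.Ioc (0 : ℝ) 1,
      s * (l1 γ - l1 β) ≤ (K *ᵥ β - b) ⬝ᵥ (γ - β) + ε * q := by
    rintro ε ⟨hε, hε1⟩
    have hmin := h (β + ε • (γ - β))
    have hsub := quad_sub hK b β (β + ε • (γ - β))
    have hconv := convexOn_l1.2 (Set.mem_univ β) (Set.mem_univ γ) (sub_nonneg.2 hε1) hε.le
      (sub_add_cancel 1 ε)
    rw [show (1 - ε) • β + ε • γ = β + ε • (γ - β) by module, smul_eq_mul, smul_eq_mul] at hconv
    simp only [add_sub_cancel_left, mulVec_smul, dotProduct_smul, smul_dotProduct,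
      smul_eq_mul] at hsub
    refine le_of_mul_le_mul_left ?_ hε
    rw [hq]
    linarith [mul_le_mul_of_nonpos_left hconv hs]
  have hlim : Filter.Tendsto (fun ε => (K *ᵥ β - b) ⬝ᵥ (γ - β) + ε * q)
      (nhdsWithin 0 (Set.Ioi 0)) (nhds ((K *ᵥ β - b) ⬝ᵥ (γ - β))) :=
    tendsto_nhdsWithin_of_tendsto_nhds (Continuous.tendsto' (by fun_prop) _ _ (by simp))
  exact ge_of_tendsto hlim (Filter.eventually_of_mem (Ioc_mem_nhdsGT one_pos) hpos)

theorem exists_isKKTPoint (hK : K.PosSemidef) {c : J → ℝ} (hc : K *ᵥ c = b) (hs : s ≤ 0) :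
    ∃ β, IsKKTPoint K b s β := by
  have hsymm := isHermitian_iff_isSymm.1 hK.isHermitian
  rcases hs.eq_or_lt with rfl | hs'
  · exact ⟨c, isKKTPoint_of_mulVec_eq hc⟩
  have hcoercive : Filter.Tendsto (fun β : J → ℝ => quad K b β - s * l1 β)
      (Filter.cocompact (J → ℝ)) Filter.atTop := by
    refine Filter.tendsto_atTop_mono (fun β => ?_) (Filter.tendsto_atTop_add_const_left _
      (quad K b c) (tendsto_norm_cocompact_atTop.const_mul_atTop (neg_pos.2 hs')))
    have hsub := quad_sub hsymm b c β
    rw [hc, sub_self, zero_dotProduct] at hsub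
    linarith [dotProduct_mulVec_nonneg hK (β - c), mul_le_mul_of_nonpos_left (norm_le_l1 β) hs]
  obtain ⟨β, hβ⟩ := ((continuous_quad K b).sub
    (continuous_l1.const_mul s)).exists_forall_le hcoercive
  exact ⟨β, isKKTPoint_of_forall_le hsymm hs hβ⟩

end KKT

section Path

variable {J : Type*} [Fintype J] {K : Matrix J J ℝ} {b β : J → ℝ} {s : ℝ}

/-- The solution path: the point that satisfies the Karush-Kuhn-Tucker conditions with parameter
`s`. It is meaningful for positive definite `K` and `s ≤ 0`. -/
def path (K : Matrix J J ℝ) (b : J → ℝ) (s : ℝ) : J → ℝ :=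
  Classical.epsilon (IsKKTPoint K b s)

lemma mulVec_inv_mulVec [DecidableEq J] (hK : K.PosDef) (b : J → ℝ) : K *ᵥ K⁻¹ *ᵥ b = b := by
  rw [mulVec_mulVec, mul_nonsing_inv _ ((isUnit_iff_isUnit_det _).1 hK.isUnit), one_mulVec]

lemma isKKTPoint_path (hK : K.PosDef) (hs : s ≤ 0) : IsKKTPoint K b s (path K b s) := by
  classical
  exact Classical.epsilon_spec (exists_isKKTPoint hK.posSemidef (mulVec_inv_mulVec hK b) hs)

lemma IsKKTPoint.eq_path (hK : K.PosDef) (hs : s ≤ 0) (h : IsKKTPoint K b s β) :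
    path K b s = β := h.unique hK (isKKTPoint_path hK hs)

lemma path_zero [DecidableEq J] (hK : K.PosDef) : path K b 0 = K⁻¹ *ᵥ b :=
  (isKKTPoint_of_mulVec_eq (mulVec_inv_mulVec hK b)).eq_path hK le_rfl

lemma neg_norm_nonpos (b : J → ℝ) : -‖b‖ ≤ 0 := neg_nonpos.2 (norm_nonneg b)

lemma path_neg_norm (hK : K.PosDef) : path K b (-‖b‖) = 0 :=
  ((isKKTPoint_zero_iff (neg_norm_nonpos b)).2 le_rfl).eq_path hK (neg_norm_nonpos b)

lemma path_ne_zero (hK : K.PosDef) (hs : s ∈ Set.Ioc (-‖b‖) 0) : path K b s ≠ 0 := fun h =>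
  hs.1.not_ge ((isKKTPoint_zero_iff hs.2).1 (h ▸ isKKTPoint_path hK hs.2))

lemma strictMonoOn_l1_path (hK : K.PosDef) :
    StrictMonoOn (fun s => l1 (path K b s)) (Set.Icc (-‖b‖) 0) := fun _ hs _ ht hst =>
  (isKKTPoint_path hK hs.2).l1_lt_l1 hK (isKKTPoint_path hK ht.2)
    (path_ne_zero hK ⟨hs.1.trans_lt hst, ht.2⟩) hst

lemma injOn_path (hK : K.PosDef) : Set.InjOn (path K b) (Set.Icc (-‖b‖) 0) :=
  fun _ hs _ ht h => (strictMonoOn_l1_path hK).injOn hs ht (congrArg l1 h)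

lemma l1_path_le (hK : K.PosDef) (hs : s ≤ 0) : l1 (path K b s) ≤ l1 (path K b 0) := by
  rcases hs.eq_or_lt with rfl | hs'
  · rfl
  · exact (isKKTPoint_path hK hs).l1_le_l1 hK.posSemidef (isKKTPoint_path hK le_rfl) hs'

/-- The path stays in a compact set, and its only possible limit at `s` is the unique
Karush-Kuhn-Tucker point with parameter `s`. -/
lemma continuousOn_path (hK : K.PosDef) : ContinuousOn (path K b) (Set.Iic 0) := by
  intro s hs
  have hmem : ∀ᶠ t in nhdsWithin s (Set.Iic 0), path K b t ∈ {β | l1 β ≤ l1 (path K b 0)} :=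
    eventually_mem_nhdsWithin.mono fun t ht => l1_path_le hK ht
  refine (isCompact_setOf_l1_le _).tendsto_nhds_of_unique_mapClusterPt hmem fun β _ hβ => ?_
  obtain ⟨l, hl, hlim⟩ := mapClusterPt_iff_ultrafilter.1 hβ
  have hkkt : IsKKTPoint K b s β := isKKTPoint_of_tendsto (hl.trans nhdsWithin_le_nhds) hlim
    (hl (eventually_mem_nhdsWithin.mono fun t ht => isKKTPoint_path hK ht))
  exact (hkkt.eq_path hK hs).symm

lemma image_l1_path [DecidableEq J] (hK : K.PosDef) :
    (fun s => l1 (path K b s)) '' Set.Icc (-‖b‖) 0 = Set.Icc 0 (l1 (K⁻¹ *ᵥ b)) := by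
  apply Set.Subset.antisymm
  · rintro _ ⟨s, hs, rfl⟩
    exact ⟨l1_nonneg _, path_zero hK (b := b) ▸ l1_path_le hK hs.2⟩
  · have hivt := intermediate_value_Icc (neg_norm_nonpos b) (continuous_l1.comp_continuousOn
      ((continuousOn_path hK (b := b)).mono Set.Icc_subset_Iic_self))
    simpa only [Function.comp_def, path_zero hK, path_neg_norm hK, l1_zero] using hivt

end Path

section SignVector

variable {J : Type*} {K : Matrix J J ℝ} {b β γ : J → ℝ} {s t : ℝ} {τ : J → SignType}

/-- The vector of the signs of the coordinates. -/
def signVector (β : J → ℝ) : J → SignType := fun j => SignType.sign (β j)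

lemma signVector_eq_zero_iff {j : J} : signVector β j = 0 ↔ β j = 0 := sign_eq_zero_iff

lemma self_mul_signVector (β : J → ℝ) (j : J) : β j * signVector β j = |β j| :=
  self_mul_sign (β j)

lemma convex_setOf_signVector_eq (τ : J → SignType) : Convex ℝ {β | signVector β = τ} := by
  have hpi : {β | signVector β = τ} = Set.univ.pi fun j => SignType.sign ⁻¹' {τ j} := by
    ext β
    simp [signVector, funext_iff]
  rw [hpi]
  exact convex_pi fun j _ =>
    (Set.ordConnected_singleton.preimage_mono (SignType.sign (α := ℝ)).monotone).convex

variable [Fintype J]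

lemma IsKKTPoint.mul_eq_of_signVector_eq (h : IsKKTPoint K b s β)
    (hγ : signVector γ = signVector β) (j : J) : (K *ᵥ β - b) j * γ j = s * |γ j| := by
  by_cases hj : β j = 0
  · have hγj : γ j = 0 := by rwa [← signVector_eq_zero_iff, hγ, signVector_eq_zero_iff]
    simp [hγj]
  · rw [h.gradient_eq hj, ← self_mul_signVector γ, hγ]
    simp only [signVector]
    ring

lemma IsKKTPoint.add_smul (h : IsKKTPoint K b s β) (h' : IsKKTPoint K b t γ) {a c : ℝ}
    (ha : 0 ≤ a) (hc : 0 ≤ c) (hac : a + c = 1) (hsign : signVector β = signVector γ) :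
    IsKKTPoint K b (a * s + c * t) (a • β + c • γ) := by
  have hgrad (j : J) : (K *ᵥ (a • β + c • γ) - b) j =
      a * (K *ᵥ β - b) j + c * (K *ᵥ γ - b) j := by
    simp only [mulVec_add, mulVec_smul, Pi.sub_apply, Pi.add_apply, Pi.smul_apply, smul_eq_mul]
    linear_combination (b j) * hac
  have hcomb : signVector (a • β + c • γ) = signVector β :=
    convex_setOf_signVector_eq _ rfl hsign.symm ha hc hac
  refine ⟨fun j => ?_, fun j => ?_⟩
  · rw [hgrad]
    calc |a * (K *ᵥ β - b) j + c * (K *ᵥ γ - b) j|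
        ≤ a * |(K *ᵥ β - b) j| + c * |(K *ᵥ γ - b) j| :=
          (abs_add_le _ _).trans_eq (by rw [abs_mul, abs_mul, abs_of_nonneg ha, abs_of_nonneg hc])
      _ ≤ a * -s + c * -t := by gcongr; exacts [h.abs_le j, h'.abs_le j]
      _ = -(a * s + c * t) := by ring
  · rw [hgrad]
    linear_combination a * h.mul_eq_of_signVector_eq hcomb j +
      c * h'.mul_eq_of_signVector_eq (hcomb.trans hsign) j

lemma ordConnected_signVector_path (hK : K.PosDef) (τ : J → SignType) :
    (Set.Icc (-‖b‖) 0 ∩ (fun s => signVector (path K b s)) ⁻¹' {τ}).OrdConnected := by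
  refine Convex.ordConnected fun s hs t ht a c ha hc hac => ?_
  have hmem := convex_Icc (-‖b‖) 0 hs.1 ht.1 ha hc hac
  have hpath : path K b (a • s + c • t) = a • path K b s + c • path K b t :=
    ((isKKTPoint_path hK hs.1.2).add_smul (isKKTPoint_path hK ht.1.2) ha hc hac
      (hs.2.trans ht.2.symm)).eq_path hK hmem.2
  exact ⟨hmem, (congrArg signVector hpath).trans
    (convex_setOf_signVector_eq τ hs.2 ht.2 ha hc hac)⟩

end SignVector

section Face

variable {J : Type*} {K : Matrix J J ℝ}

/-- The matrix of the quadratic function on a coordinate face. -/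
def faceMatrix (K : Matrix J J ℝ) (A : Finset J) : Matrix A A ℝ :=
  K.submatrix Subtype.val Subtype.val

lemma posDef_faceMatrix (hK : K.PosDef) (A : Finset J) : (faceMatrix K A).PosDef :=
  hK.submatrix Subtype.val_injective

variable [DecidableEq J]

/-- The vector on the coordinate face of `A` whose image under `K` agrees with `u` on `A`. -/
def faceSolve (K : Matrix J J ℝ) (A : Finset J) (u : A → ℝ) : J → ℝ :=
  extendZero A ((faceMatrix K A)⁻¹ *ᵥ u)

lemma extendZero_add_smul (A : Finset J) (u w : A → ℝ) (s : ℝ) :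
    extendZero A (u + s • w) = extendZero A u + s • extendZero A w := by
  ext j
  by_cases h : j ∈ A <;> simp [extendZero, h]

lemma faceSolve_add_smul (A : Finset J) (u w : A → ℝ) (s : ℝ) :
    faceSolve K A (u + s • w) = faceSolve K A u + s • faceSolve K A w := by
  rw [faceSolve, mulVec_add, mulVec_smul, extendZero_add_smul, faceSolve, faceSolve]

lemma faceSolve_apply_of_notMem {A : Finset J} {j : J} (hj : j ∉ A) (u : A → ℝ) :
    faceSolve K A u j = 0 := dif_neg hj

variable [Fintype J]

lemma mulVec_extendZero (K : Matrix J J ℝ) (A : Finset J) (u : A → ℝ) (j : A) :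
    (K *ᵥ extendZero A u) j = (faceMatrix K A *ᵥ u) j := by
  simp only [mulVec, dotProduct]
  rw [← Finset.sum_subset (Finset.subset_univ A) fun l _ hl => by simp [extendZero, hl],
    ← Finset.sum_coe_sort]
  exact Finset.sum_congr rfl fun l _ => by simp [extendZero, faceMatrix]

lemma mulVec_faceSolve (hK : K.PosDef) (A : Finset J) (u : A → ℝ) (j : A) :
    (K *ᵥ faceSolve K A u) j = u j := by
  rw [faceSolve, mulVec_extendZero, mulVec_inv_mulVec (posDef_faceMatrix hK A)]

lemma eq_faceSolve (hK : K.PosDef) {A : Finset J} {u : A → ℝ} {β : J → ℝ}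
    (hβ : ∀ j ∉ A, β j = 0) (hu : ∀ j : A, (K *ᵥ β) j = u j) : β = faceSolve K A u := by
  refine sub_eq_zero.1 (eq_zero_of_dotProduct_mulVec_nonpos hK (le_of_eq ?_))
  refine Finset.sum_eq_zero fun j _ => ?_
  by_cases hj : j ∈ A
  · rw [mulVec_sub, Pi.sub_apply (K *ᵥ β), hu ⟨j, hj⟩, mulVec_faceSolve hK A u ⟨j, hj⟩, sub_self,
      mul_zero]
  · rw [Pi.sub_apply, hβ j hj, faceSolve_apply_of_notMem hj, sub_self, zero_mul]

end Face

section Direction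

variable {J : Type*} [Fintype J] {K : Matrix J J ℝ} {b β γ d : J → ℝ} {s t c : ℝ}
  {τ τ' : J → SignType}

/-- The support of a sign vector. -/
def face (τ : J → SignType) : Finset J := {j | τ j ≠ 0}

lemma mem_face {j : J} : j ∈ face τ ↔ τ j ≠ 0 := by simp [face]

lemma face_nonempty (hτ : τ ≠ 0) : (face τ).Nonempty :=
  (Function.ne_iff.1 hτ).imp fun _ => mem_face.2

/-- The signs of a sign vector on its support. -/
def faceSign (τ : J → SignType) : face τ → ℝ := fun j => τ j

lemma injective_signType_cast : Function.Injective ((↑) : SignType → ℝ) := by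
  rintro (_ | _ | _) (_ | _ | _) h <;> first | rfl | norm_num at h

lemma faceSign_eq_one_or_eq_neg_one (j : face τ) : faceSign τ j = 1 ∨ faceSign τ j = -1 := by
  have hj := mem_face.1 j.2
  rcases h : τ j with _ | _ | _ <;> simp_all [faceSign]

/-- The direction in which a Karush-Kuhn-Tucker point with sign vector `τ` moves when its parameter
grows and its signs do not change. -/
structure IsDirection (K : Matrix J J ℝ) (τ : J → SignType) (d : J → ℝ) : Prop where
  eq_zero : ∀ j, τ j = 0 → d j = 0
  mulVec_eq : ∀ j, τ j ≠ 0 → (K *ᵥ d) j = τ j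

lemma isDirection_faceSolve [DecidableEq J] (hK : K.PosDef) (τ : J → SignType) :
    IsDirection K τ (faceSolve K (face τ) (faceSign τ)) :=
  ⟨fun _ hj => faceSolve_apply_of_notMem (fun h => mem_face.1 h hj) _,
    fun j hj => mulVec_faceSolve hK (face τ) (faceSign τ) ⟨j, mem_face.2 hj⟩⟩

lemma IsKKTPoint.eq_faceSolve_add [DecidableEq J] (hK : K.PosDef) (h : IsKKTPoint K b s β)
    (hτ : signVector β = τ) :
    β = faceSolve K (face τ) (fun j => b j) + s • faceSolve K (face τ) (faceSign τ) := by
  subst hτ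
  rw [← faceSolve_add_smul]
  refine eq_faceSolve hK (fun j hj => ?_) fun j => ?_
  · rwa [mem_face, not_not, signVector_eq_zero_iff] at hj
  · have hgrad := h.gradient_eq (signVector_eq_zero_iff.not.1 (mem_face.1 j.2))
    exact sub_eq_iff_eq_add'.1 hgrad

namespace IsDirection

lemma dotProduct_mulVec (hd : IsDirection K (signVector β) d) : β ⬝ᵥ K *ᵥ d = l1 β := by
  refine Finset.sum_congr rfl fun j _ => ?_
  by_cases hj : β j = 0
  · simp [hj]
  · rw [hd.mulVec_eq j (signVector_eq_zero_iff.not.2 hj), self_mul_signVector]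

lemma l1_eq (hK : K.IsSymm) (h : IsKKTPoint K b s β) (hd : IsDirection K (signVector β) d) :
    l1 β = d ⬝ᵥ b + s * (d ⬝ᵥ K *ᵥ d) := by
  have hgrad : d ⬝ᵥ (K *ᵥ β - b) = s * (d ⬝ᵥ K *ᵥ d) := by
    simp only [dotProduct, Finset.mul_sum]
    refine Finset.sum_congr rfl fun j _ => ?_
    by_cases hj : β j = 0
    · simp [hd.eq_zero j (signVector_eq_zero_iff.2 hj)]
    · rw [h.gradient_eq hj, hd.mulVec_eq j (signVector_eq_zero_iff.not.2 hj)]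
      simp only [signVector]
      ring
  rw [dotProduct_sub, dotProduct_mulVec_comm hK, hd.dotProduct_mulVec] at hgrad
  linarith

/-- Equality holds in the Cauchy-Schwarz inequality for `γ - β` and `d`. -/
lemma sub_eq_smul (hK : K.PosDef) (h : IsKKTPoint K b s β) (h' : IsKKTPoint K b t γ)
    (hd : IsDirection K (signVector β) d) (hd' : IsDirection K (signVector γ) d) :
    γ - β = (t - s) • d := by
  have hsymm := isHermitian_iff_isSymm.1 hK.isHermitian
  refine sub_eq_zero.1 (eq_zero_of_dotProduct_mulVec_nonpos hK ?_)
  have hl1 : l1 γ - l1 β = (t - s) * (d ⬝ᵥ K *ᵥ d) := by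
    rw [hd.l1_eq hsymm h, hd'.l1_eq hsymm h']
    ring
  have hdir : (γ - β) ⬝ᵥ K *ᵥ d = l1 γ - l1 β := by
    rw [sub_dotProduct, hd'.dotProduct_mulVec, hd.dotProduct_mulVec]
  calc (γ - β - (t - s) • d) ⬝ᵥ K *ᵥ (γ - β - (t - s) • d)
      = (γ - β) ⬝ᵥ K *ᵥ (γ - β) - 2 * (t - s) * (l1 γ - l1 β) +
          (t - s) ^ 2 * (d ⬝ᵥ K *ᵥ d) := by rw [dotProduct_mulVec_sub_smul hsymm, hdir]
    _ ≤ (t - s) * (l1 γ - l1 β) - 2 * (t - s) * (l1 γ - l1 β) + (t - s) ^ 2 * (d ⬝ᵥ K *ᵥ d) := by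
        gcongr
        exact h.dotProduct_mulVec_le h'
    _ = 0 := by rw [hl1]; ring

lemma signVector_eq_of_sub_eq_smul (hd : IsDirection K (signVector β) d)
    (hd' : IsDirection K (signVector γ) d) (h : γ - β = c • d) : signVector β = signVector γ := by
  have hzero (j : J) (hj : d j = 0) : β j = γ j := by
    have hsub := congrFun h j
    rw [Pi.sub_apply, Pi.smul_apply, hj, smul_zero, sub_eq_zero] at hsub
    exact hsub.symm
  ext j
  by_cases hβ : signVector β j = 0
  · exact congrArg SignType.sign (hzero j (hd.eq_zero j hβ))
  by_cases hγ : signVector γ j = 0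
  · exact congrArg SignType.sign (hzero j (hd'.eq_zero j hγ))
  · exact injective_signType_cast ((hd.mulVec_eq j hβ).symm.trans (hd'.mulVec_eq j hγ))

lemma eq_one_or_eq_neg_one (hd : IsDirection K τ d) (hd' : IsDirection K τ' (c • d))
    (hτ' : τ' ≠ 0) : c = 1 ∨ c = -1 := by
  obtain ⟨j, hj⟩ : ∃ j, (c • d) j ≠ 0 := by
    by_contra! hcd
    obtain ⟨i, hi⟩ := Function.ne_iff.1 hτ'
    have hKi := hd'.mulVec_eq i hi
    rw [show c • d = 0 from funext hcd, mulVec_zero] at hKi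
    exact hi (injective_signType_cast (by simpa using hKi.symm))
  have hτ'j : τ' j ≠ 0 := fun h => hj (hd'.eq_zero j h)
  have hτj : τ j ≠ 0 := fun h => hj (by simp [hd.eq_zero j h])
  have hc : (τ' j : ℝ) = c * τ j := by
    rw [← hd'.mulVec_eq j hτ'j, ← hd.mulVec_eq j hτj, mulVec_smul, Pi.smul_apply, smul_eq_mul]
  have sq_eq_one {σ : SignType} (hσ : σ ≠ 0) : (σ : ℝ) ^ 2 = 1 := by
    rcases σ with _ | _ | _ <;> simp_all
  have hsq := congrArg (· ^ 2) hc
  simp only [mul_pow, sq_eq_one hτj, sq_eq_one hτ'j, mul_one] at hsq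
  exact sq_eq_one_iff.1 hsq.symm

/-- Opposite directions cannot occur: the values of `l1` at the two points would add up to
`(s + t) * (d ⬝ᵥ K *ᵥ d) ≤ 0`. -/
lemma signVector_eq_of_smul (hK : K.PosDef) (hs : s ≤ 0) (ht : t ≤ 0) (h : IsKKTPoint K b s β)
    (h' : IsKKTPoint K b t γ) (hγ : γ ≠ 0) (hd : IsDirection K (signVector β) d)
    (hd' : IsDirection K (signVector γ) (c • d)) : signVector β = signVector γ := by
  have hsign : signVector γ ≠ 0 := fun h0 =>
    hγ (funext fun j => signVector_eq_zero_iff.1 (congrFun h0 j))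
  rcases hd.eq_one_or_eq_neg_one hd' hsign with rfl | rfl
  · rw [one_smul] at hd'
    exact hd.signVector_eq_of_sub_eq_smul hd' (hd.sub_eq_smul hK h h' hd')
  · exfalso
    have hsymm := isHermitian_iff_isSymm.1 hK.isHermitian
    have hβl1 := hd.l1_eq hsymm h
    have hγl1 := hd'.l1_eq hsymm h'
    rw [neg_one_smul, mulVec_neg, neg_dotProduct_neg, neg_dotProduct] at hγl1
    have hle : (s + t) * (d ⬝ᵥ K *ᵥ d) ≤ 0 :=
      mul_nonpos_of_nonpos_of_nonneg (add_nonpos hs ht) (dotProduct_mulVec_nonneg hK.posSemidef d)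
    linarith [l1_nonneg β, l1_pos.2 hγ]

end IsDirection

end Direction

section Knots

variable {J : Type*} [Fintype J] {K : Matrix J J ℝ} {b : J → ℝ} {m : ℕ} {σ : Fin (m + 1) → ℝ}
  {τ : Fin m → J → SignType}

/-- The points `σ` cut the parameter interval of the path into subintervals on which its sign
vector is constant, with the distinct values `τ`. -/
structure IsKnotSequence (K : Matrix J J ℝ) (b : J → ℝ) (σ : Fin (m + 1) → ℝ)
    (τ : Fin m → J → SignType) : Prop where
  strictAnti : StrictAnti σ
  zero : σ 0 = 0
  last : σ (Fin.last m) = -‖b‖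
  injective : Function.Injective τ
  signVector_eq : ∀ i, ∀ s ∈ Set.Ioo (σ i.succ) (σ i.castSucc), signVector (path K b s) = τ i

lemma exists_isKnotSequence (hK : K.PosDef) (b : J → ℝ) :
    ∃ (m : ℕ) (σ : Fin (m + 1) → ℝ) (τ : Fin m → J → SignType), IsKnotSequence K b σ τ := by
  classical
  obtain ⟨m, σ, τ, hσ, hzero, hlast, hτ, hsign⟩ :=
    PolygonalChain.exists_strictAnti_injective_const_on_Ioo (neg_norm_nonpos b)
      (ordConnected_signVector_path hK)
  exact ⟨m, σ, τ, hσ, hzero, hlast, hτ, hsign⟩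

namespace IsKnotSequence

lemma lt (h : IsKnotSequence K b σ τ) (i : Fin m) : σ i.succ < σ i.castSucc :=
  h.strictAnti i.castSucc_lt_succ

lemma Icc_subset (h : IsKnotSequence K b σ τ) (i : Fin m) :
    Set.Icc (σ i.succ) (σ i.castSucc) ⊆ Set.Icc (-‖b‖) 0 :=
  h.last ▸ h.zero ▸ PolygonalChain.Icc_subset_Icc_of_antitone h.strictAnti.antitone i

lemma exists_path_ne_zero (hK : K.PosDef) (h : IsKnotSequence K b σ τ) (i : Fin m) :
    ∃ s ≤ 0, path K b s ≠ 0 ∧ signVector (path K b s) = τ i := by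
  obtain ⟨s, hs⟩ := Set.nonempty_Ioo.2 (h.lt i)
  have hIcc := h.Icc_subset i (Set.left_mem_Icc.2 (h.lt i).le)
  have hnonpos := (h.Icc_subset i (Set.Ioo_subset_Icc_self hs)).2
  exact ⟨s, hnonpos, path_ne_zero hK ⟨hIcc.1.trans_lt hs.1, hnonpos⟩, h.signVector_eq i s hs⟩

lemma ne_zero (hK : K.PosDef) (h : IsKnotSequence K b σ τ) (i : Fin m) : τ i ≠ 0 := by
  obtain ⟨s, -, hne, hsign⟩ := h.exists_path_ne_zero hK i
  exact fun h0 => hne (funext fun j => signVector_eq_zero_iff.1 (congrFun (hsign.trans h0) j))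

lemma faceSign_mul_path_pos (h : IsKnotSequence K b σ τ) {i : Fin m} {s : ℝ}
    (hs : s ∈ Set.Ioo (σ i.succ) (σ i.castSucc)) (j : face (τ i)) :
    0 < faceSign (τ i) j * path K b s j := by
  have hsign : signVector (path K b s) j = τ i j := congrFun (h.signVector_eq i s hs) j
  have hne : path K b s j ≠ 0 := signVector_eq_zero_iff.not.1 (hsign ▸ mem_face.1 j.2)
  rw [faceSign, ← hsign, mul_comm, self_mul_signVector]
  exact abs_pos.2 hne

lemma isPiecewiseAffine [DecidableEq J] (hK : K.PosDef) (h : IsKnotSequence K b σ τ) :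
    PolygonalChain.IsPiecewiseAffine σ (path K b)
      (fun i => faceSolve K (face (τ i)) fun j => b j)
      (fun i => faceSolve K (face (τ i)) (faceSign (τ i))) where
  strictAnti := h.strictAnti
  eqOn i := by
    have hIoo : Set.EqOn (path K b) (fun s => faceSolve K (face (τ i)) (fun j => b j) +
        s • faceSolve K (face (τ i)) (faceSign (τ i))) (Set.Ioo (σ i.succ) (σ i.castSucc)) :=
      fun s hs =>
        have hnonpos := (h.Icc_subset i (Set.Ioo_subset_Icc_self hs)).2
        (isKKTPoint_path hK hnonpos).eq_faceSolve_add hK (h.signVector_eq i s hs)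
    exact hIoo.of_subset_closure
      ((continuousOn_path hK).mono fun s hs => (h.Icc_subset i hs).2) (by fun_prop)
      Set.Ioo_subset_Icc_self (closure_Ioo (h.lt i).ne).ge

lemma isSimple (hK : K.PosDef) (h : IsKnotSequence K b σ τ) :
    PolygonalChain.IsSimple (path K b ∘ σ) := by
  classical
  exact (h.isPiecewiseAffine hK).isSimple (by simpa only [h.zero, h.last] using injOn_path hK)

lemma image_path (hK : K.PosDef) (h : IsKnotSequence K b σ τ) :
    path K b '' Set.Icc (-‖b‖) 0 = PolygonalChain.trace (path K b ∘ σ) := by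
  classical
  simpa only [h.zero, h.last] using (h.isPiecewiseAffine hK).image_Icc_eq_trace

lemma noParallel (hK : K.PosDef) (h : IsKnotSequence K b σ τ) :
    PolygonalChain.NoParallel (path K b ∘ σ) := by
  classical
  intro i j hij hpar
  obtain ⟨c, hc⟩ := (h.isPiecewiseAffine hK).exists_eq_smul_of_parallel hpar
  have hd := isDirection_faceSolve hK (τ i)
  have hd' := isDirection_faceSolve hK (τ j)
  rw [hc] at hd'
  obtain ⟨s, hs, -, hsign⟩ := h.exists_path_ne_zero hK i
  obtain ⟨t, ht, hne, hsign'⟩ := h.exists_path_ne_zero hK j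
  refine hij (h.injective ?_)
  generalize faceSolve K (face (τ i)) (faceSign (τ i)) = d at hd hd'
  rw [← hsign] at hd ⊢
  rw [← hsign'] at hd' ⊢
  exact hd.signVector_eq_of_smul hK hs ht (isKKTPoint_path hK hs) (isKKTPoint_path hK ht) hne hd'

end IsKnotSequence

end Knots

section Centered

variable {N : ℕ} {J : Type*} {x : Fin N → J → ℝ}

lemma sum_sub_mean (z : Fin N → ℝ) : ∑ i, (z i - mean z) = 0 := by
  rcases N.eq_zero_or_pos with rfl | hN
  · simp
  · rw [Finset.sum_sub_distrib, Finset.sum_const, Finset.card_univ, Fintype.card_fin, nsmul_eq_mul,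
      mean, mul_div_cancel₀ _ (by positivity), sub_self]

/-- The matrix of the deviations of the predictors from their means. -/
def centered (x : Fin N → J → ℝ) : Matrix (Fin N) J ℝ :=
  Matrix.of fun i j => x i j - mean fun k => x k j

lemma covMatrix_eq (x : Fin N → J → ℝ) :
    covMatrix x = (N : ℝ)⁻¹ • ((centered x)ᵀ * centered x) := by
  ext j l
  simp [covMatrix, mean, centered, mul_apply, div_eq_inv_mul]

lemma covVector_eq (x : Fin N → J → ℝ) (y : Fin N → ℝ) :
    covVector x y = (N : ℝ)⁻¹ • ((centered x)ᵀ *ᵥ fun i => y i - mean y) := by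
  ext j
  simp [covVector, mean, centered, mulVec, dotProduct, div_eq_inv_mul]

lemma FullRank.pos (hx : FullRank x) : 0 < N := by
  have hne : (affineSpan ℝ (Set.range x) : Set (J → ℝ)).Nonempty := by
    rw [hx]
    exact Set.univ_nonempty
  exact Fin.pos_iff_nonempty.2 (Set.range_nonempty_iff_nonempty.1 ((affineSpan_nonempty ℝ).1 hne))

variable [Fintype J]

lemma centered_mulVec (x : Fin N → J → ℝ) (v : J → ℝ) (i : Fin N) :
    (centered x *ᵥ v) i = ∑ j, v j * x i j - ∑ j, v j * mean fun k => x k j := by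
  simp only [mulVec, dotProduct, centered, of_apply, ← Finset.sum_sub_distrib]
  exact Finset.sum_congr rfl fun j _ => by ring

lemma sum_centered_mulVec (x : Fin N → J → ℝ) (v : J → ℝ) : ∑ i, (centered x *ᵥ v) i = 0 := by
  simp only [mulVec, dotProduct, centered, of_apply]
  rw [Finset.sum_comm]
  exact Finset.sum_eq_zero fun j _ => by
    rw [← Finset.sum_mul, sum_sub_mean fun k => x k j, zero_mul]

lemma dotProduct_covMatrix_mulVec (x : Fin N → J → ℝ) (v : J → ℝ) :
    v ⬝ᵥ covMatrix x *ᵥ v = (N : ℝ)⁻¹ * ∑ i, (centered x *ᵥ v) i ^ 2 := by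
  rw [covMatrix_eq, smul_mulVec, dotProduct_smul, ← mulVec_mulVec, dotProduct_mulVec,
    vecMul_transpose]
  simp only [dotProduct, sq, smul_eq_mul]

lemma covVector_dotProduct (x : Fin N → J → ℝ) (y : Fin N → ℝ) (v : J → ℝ) :
    covVector x y ⬝ᵥ v = (N : ℝ)⁻¹ * ∑ i, (y i - mean y) * (centered x *ᵥ v) i := by
  rw [covVector_eq, smul_dotProduct, dotProduct_comm, dotProduct_mulVec, vecMul_transpose,
    dotProduct_comm, smul_eq_mul, dotProduct]

/-- A vector `v` in the kernel confines the predictors to the hyperplane through their centroid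
orthogonal to `v`. -/
lemma FullRank.injective_centered_mulVec (hx : FullRank x) :
    Function.Injective (centered x).mulVec := by
  refine (injective_iff_map_eq_zero (centered x).mulVecLin).2 fun v hv => ?_
  let c : J → ℝ := fun j => mean fun k => x k j
  let L : (J → ℝ) →ₗ[ℝ] ℝ := Fintype.linearCombination ℝ v
  have hL (z : J → ℝ) : L z = ∑ j, v j * z j := by
    simp [L, Fintype.linearCombination_apply, mul_comm]
  have hsub : affineSpan ℝ (Set.range x) ≤ AffineSubspace.mk' c L.ker := by
    rw [affineSpan_le]
    rintro _ ⟨i, rfl⟩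
    rw [SetLike.mem_coe, AffineSubspace.mem_mk', vsub_eq_sub, LinearMap.mem_ker, map_sub, hL, hL,
      ← centered_mulVec]
    exact congrFun hv i
  have hmem : c + v ∈ AffineSubspace.mk' c L.ker := hsub (hx ▸ AffineSubspace.mem_top ..)
  rw [AffineSubspace.mem_mk', vsub_eq_sub, add_sub_cancel_left, LinearMap.mem_ker, hL] at hmem
  exact dotProduct_self_eq_zero.1 hmem

end Centered

lemma FullRank.posDef {N : ℕ} {J : Type*} [Finite J] {x : Fin N → J → ℝ} (hx : FullRank x) :
    (covMatrix x).PosDef := by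
  have := Fintype.ofFinite J
  have hN : (0 : ℝ) < (N : ℝ)⁻¹ := inv_pos.2 (Nat.cast_pos.2 hx.pos)
  rw [covMatrix_eq, ← conjTranspose_eq_transpose_of_trivial]
  exact (PosDef.conjTranspose_mul_self _ hx.injective_centered_mulVec).smul hN

section Objective

variable {N : ℕ} {J : Type*} [Fintype J] {x : Fin N → J → ℝ} {y : Fin N → ℝ} {t : ℝ} {β : J → ℝ}

/-- The constant is the minimum for slopes `0`; the last square measures how far `β₀` is from the
optimal intercept for the slopes `β`. -/
lemma objective_eq (hN : 0 < N) (x : Fin N → J → ℝ) (y : Fin N → ℝ) (β₀ : ℝ) (β : J → ℝ) :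
    objective x y β₀ β = 1 / 2 * ∑ i, (y i - mean y) ^ 2 +
      N * quad (covMatrix x) (covVector x y) β +
      N / 2 * (β₀ - (mean y - ∑ j, β j * mean fun k => x k j)) ^ 2 := by
  have hN' : (N : ℝ) ≠ 0 := by positivity
  set r := β₀ - (mean y - ∑ j, β j * mean fun k => x k j) with hr
  have hsq (i : Fin N) : (y i - β₀ - ∑ j, β j * x i j) ^ 2 = (y i - mean y) ^ 2 +
      (centered x *ᵥ β) i ^ 2 - 2 * ((y i - mean y) * (centered x *ᵥ β) i) +
      (2 * r * ((centered x *ᵥ β) i - (y i - mean y)) + r ^ 2) := by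
    rw [centered_mulVec, hr]
    ring
  have hcross : ∑ i, 2 * r * ((centered x *ᵥ β) i - (y i - mean y)) = 0 := by
    rw [← Finset.mul_sum, Finset.sum_sub_distrib, sum_centered_mulVec, sum_sub_mean, sub_zero,
      mul_zero]
  simp only [objective, hsq, Finset.sum_add_distrib, Finset.sum_sub_distrib, hcross,
    ← Finset.mul_sum, Finset.sum_const, Finset.card_univ, Fintype.card_fin, nsmul_eq_mul]
  rw [quad, dotProduct_covMatrix_mulVec, covVector_dotProduct]
  field_simp
  ring

lemma exists_forall_objective_le_iff (hN : 0 < N) (P : (J → ℝ) → Prop) :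
    (∃ β₀, ∀ γ₀ γ, P γ → objective x y β₀ β ≤ objective x y γ₀ γ) ↔
      ∀ γ, P γ → quad (covMatrix x) (covVector x y) β ≤ quad (covMatrix x) (covVector x y) γ := by
  have hN' : (0 : ℝ) < N := Nat.cast_pos.2 hN
  simp only [objective_eq hN]
  constructor
  · rintro ⟨β₀, h⟩ γ hγ
    have hmin := h (mean y - ∑ j, γ j * mean fun k => x k j) γ hγ
    rw [sub_self] at hmin
    have hsq := sq_nonneg (β₀ - (mean y - ∑ j, β j * mean fun k => x k j))
    exact le_of_mul_le_mul_left (by linarith [mul_nonneg (half_pos hN').le hsq]) hN'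
  · refine fun h => ⟨mean y - ∑ j, β j * mean fun k => x k j, fun γ₀ γ hγ => ?_⟩
    rw [sub_self]
    have hsq := sq_nonneg (γ₀ - (mean y - ∑ j, γ j * mean fun k => x k j))
    linarith [mul_le_mul_of_nonneg_left (h γ hγ) hN'.le, mul_nonneg (half_pos hN').le hsq]

lemma isLassoSolution_iff (hN : 0 < N) :
    IsLassoSolution x y t β ↔ l1 β ≤ t ∧ ∀ γ, l1 γ ≤ t →
      quad (covMatrix x) (covVector x y) β ≤ quad (covMatrix x) (covVector x y) γ := by
  rw [IsLassoSolution, exists_forall_objective_le_iff hN]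

lemma isLeastSquares_iff (hN : 0 < N) :
    IsLeastSquares x y β ↔ ∀ γ,
      quad (covMatrix x) (covVector x y) β ≤ quad (covMatrix x) (covVector x y) γ := by
  simpa only [IsLeastSquares, true_implies] using
    exists_forall_objective_le_iff (x := x) (y := y) (β := β) hN fun _ => True

end Objective

section LassoPath

variable {N : ℕ} {J : Type*} [Fintype J] {x : Fin N → J → ℝ} {y : Fin N → ℝ} {s t : ℝ}
  {β γ : J → ℝ}

lemma IsKKTPoint.isLeastSquares_iff (hx : FullRank x)
    (h : IsKKTPoint (covMatrix x) (covVector x y) 0 β) : IsLeastSquares x y γ ↔ γ = β := by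
  rw [Lasso.isLeastSquares_iff hx.pos]
  refine ⟨fun hγ => h.eq_of_quad_le hx.posDef (by simp) (hγ β), ?_⟩
  rintro rfl δ
  exact h.quad_le hx.posDef.posSemidef (by simp)

/-- The hypothesis `hst` is complementary slackness. -/
lemma IsKKTPoint.isLassoSolution_iff (hx : FullRank x)
    (h : IsKKTPoint (covMatrix x) (covVector x y) s β) (hs : s ≤ 0) (hβ : l1 β ≤ t)
    (hst : s * l1 β = s * t) : IsLassoSolution x y t γ ↔ γ = β := by
  have mul_l1_le {δ : J → ℝ} (hδ : l1 δ ≤ t) : s * l1 β ≤ s * l1 δ :=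
    hst.trans_le (mul_le_mul_of_nonpos_left hδ hs)
  rw [Lasso.isLassoSolution_iff hx.pos]
  refine ⟨fun hγ => h.eq_of_quad_le hx.posDef (mul_l1_le hγ.1) (hγ.2 β hβ), ?_⟩
  rintro rfl
  exact ⟨hβ, fun δ hδ => h.quad_le hx.posDef.posSemidef (mul_l1_le hδ)⟩

lemma isKKTPoint_center [DecidableEq J] (hx : FullRank x) :
    IsKKTPoint (covMatrix x) (covVector x y) 0 (center x y) :=
  isKKTPoint_of_mulVec_eq (mulVec_inv_mulVec hx.posDef _)

theorem isLeastSquares_iff_eq_center [DecidableEq J] (hx : FullRank x) :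
    IsLeastSquares x y γ ↔ γ = center x y :=
  (isKKTPoint_center hx).isLeastSquares_iff hx

/-- The path of lasso solutions of a data set, parametrized by `s ∈ [-‖b‖, 0]`, where `b` is the
covariance vector and `‖b‖` its maximum norm. -/
abbrev lassoPath (x : Fin N → J → ℝ) (y : Fin N → ℝ) : ℝ → J → ℝ :=
  path (covMatrix x) (covVector x y)

theorem isLassoSolution_iff_eq_lassoPath (hx : FullRank x) (hs : s ≤ 0) :
    IsLassoSolution x y (l1 (lassoPath x y s)) γ ↔ γ = lassoPath x y s :=
  (isKKTPoint_path hx.posDef hs).isLassoSolution_iff hx hs le_rfl rfl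

lemma lassoPath_zero [DecidableEq J] (hx : FullRank x) : lassoPath x y 0 = center x y :=
  path_zero hx.posDef

lemma IsLassoSolution.exists_eq_lassoPath [DecidableEq J] (hx : FullRank x)
    (h : IsLassoSolution x y t γ) :
    ∃ s ≤ 0, γ = lassoPath x y s ∧ l1 γ = min t (l1 (center x y)) := by
  rcases le_total t (l1 (center x y)) with ht | ht
  · have hmem : t ∈ Set.Icc 0 (l1 (center x y)) := ⟨(l1_nonneg γ).trans h.1, ht⟩
    rw [center, ← image_l1_path hx.posDef] at hmem
    obtain ⟨s, hs, rfl⟩ := hmem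
    obtain rfl := (isLassoSolution_iff_eq_lassoPath hx hs.2).1 h
    exact ⟨s, hs.2, rfl, (min_eq_left ht).symm⟩
  · obtain rfl := ((isKKTPoint_center hx).isLassoSolution_iff hx le_rfl ht (by simp)).1 h
    exact ⟨0, le_rfl, (lassoPath_zero hx).symm, (min_eq_right ht).symm⟩

lemma sign_eq_signType_sign (r : ℝ) : Real.sign r = SignType.sign r := by
  rcases lt_trichotomy r 0 with h | rfl | h
  · simp [Real.sign_of_neg, sign_neg, h]
  · simp
  · simp [Real.sign_of_pos, sign_pos, h]

theorem isLassoSolutionAt_iff_eq_lassoPath (hx : FullRank x)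
    (hs : s ∈ Set.Ioc (-‖covVector x y‖) 0) :
    IsLassoSolutionAt x y s γ ↔ γ = lassoPath x y s := by
  classical
  have hK := hx.posDef
  simp only [IsLassoSolutionAt, sign_eq_signType_sign]
  constructor
  · rintro ⟨⟨t, ht, h⟩, hgrad⟩
    obtain ⟨r, hr, rfl, hl1⟩ := h.exists_eq_lassoPath hx
    have hcenter : center x y ≠ 0 :=
      lassoPath_zero (y := y) hx ▸ path_ne_zero hK ⟨hs.1.trans_le hs.2, le_rfl⟩
    have hne : lassoPath x y r ≠ 0 := l1_pos.1 (hl1 ▸ lt_min ht (l1_pos.2 hcenter))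
    rw [(isKKTPoint_path hK hr).param_eq_of_gradient_eq hne hgrad]
  · rintro rfl
    exact ⟨⟨l1 (lassoPath x y s), l1_pos.2 (path_ne_zero hK hs),
      (isLassoSolution_iff_eq_lassoPath hx hs.2).2 rfl⟩,
      fun j hj => (isKKTPoint_path hK hs.2).gradient_eq hj⟩

end LassoPath

section Rays

variable {N : ℕ} {J : Type*} [DecidableEq J] {x : Fin N → J → ℝ} {y : Fin N → ℝ} {m : ℕ}
  {σ : Fin (m + 1) → ℝ} {τ : Fin m → J → SignType}

lemma extendZero_rayPoint_induced (x : Fin N → J → ℝ) (y : Fin N → ℝ) (A : Finset J) (δ : A → ℝ)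
    (s : ℝ) : extendZero A (rayPoint (induced x A) y δ s) =
      faceSolve (covMatrix x) A (fun j => covVector x y j) + s • faceSolve (covMatrix x) A δ :=
  extendZero_add_smul A _ _ s

variable [Fintype J]

namespace IsKnotSequence

lemma eqOn_lassoPath (hx : FullRank x) (h : IsKnotSequence (covMatrix x) (covVector x y) σ τ)
    (i : Fin m) :
    Set.EqOn (lassoPath x y)
      (fun s => extendZero (face (τ i)) (rayPoint (induced x (face (τ i))) y (faceSign (τ i)) s))
      (Set.Icc (σ i.succ) (σ i.castSucc)) := by
  simpa only [extendZero_rayPoint_induced] using (h.isPiecewiseAffine hx.posDef).eqOn i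

lemma edge_subset_ray (hx : FullRank x) (h : IsKnotSequence (covMatrix x) (covVector x y) σ τ)
    (i : Fin m) :
    PolygonalChain.edge (lassoPath x y ∘ σ) i ⊆
      extendZero (face (τ i)) '' ray (induced x (face (τ i))) y (faceSign (τ i)) := by
  rw [(h.isPiecewiseAffine hx.posDef).edge_eq_image, (h.eqOn_lassoPath hx i).image_eq, ray,
    Set.image_image]
  exact Set.image_mono fun s hs => (h.Icc_subset i hs).2

end IsKnotSequence

end Rays

end Lasso

end

theorem mainTheorem1_general {N : ℕ} {J : Type*} [Fintype J] [DecidableEq J] (x : Fin N → J → ℝ)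
    (y : Fin N → ℝ) (hx : Lasso.FullRank x) :
    (∀ γ : J → ℝ, Lasso.IsLeastSquares x y γ ↔ γ = Lasso.center x y) ∧
    ∃ (s' : ℝ) (β : ℝ → J → ℝ),
      (∀ s ∈ Set.Ioc s' 0, ∀ γ : J → ℝ, Lasso.IsLassoSolutionAt x y s γ ↔ γ = β s) ∧
      StrictMonoOn (fun s => Lasso.l1 (β s)) (Set.Icc s' 0) ∧
      (fun s => Lasso.l1 (β s)) '' Set.Icc s' 0 = Set.Icc 0 (Lasso.l1 (Lasso.center x y)) ∧
      (∀ s ∈ Set.Icc s' 0, ∀ γ : J → ℝ,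
        Lasso.IsLassoSolution x y (Lasso.l1 (β s)) γ ↔ γ = β s) ∧
      ∃ (m : ℕ) (σ : Fin (m + 1) → ℝ) (v : Fin (m + 1) → J → ℝ),
        StrictAnti σ ∧ σ 0 = 0 ∧ σ (Fin.last m) = s' ∧
        (∀ i, v i = β (σ i)) ∧
        v 0 = Lasso.center x y ∧ v (Fin.last m) = 0 ∧
        PolygonalChain.IsSimple v ∧
        β '' Set.Icc s' 0 = PolygonalChain.trace v ∧
        PolygonalChain.NoParallel v ∧
        ∀ i : Fin m, ∃ (A : Finset J) (δ : A → ℝ),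
          A.Nonempty ∧ (∀ j, δ j = 1 ∨ δ j = -1) ∧
          PolygonalChain.edge v i ⊆
            Lasso.extendZero A '' Lasso.ray (Lasso.induced x A) y δ ∧
          (∀ s ∈ Set.Icc (σ i.succ) (σ i.castSucc),
            β s = Lasso.extendZero A (Lasso.rayPoint (Lasso.induced x A) y δ s)) ∧
          (∀ s ∈ Set.Ioo (σ i.succ) (σ i.castSucc), ∀ j : A, 0 < δ j * β s j) := by
  have hK := hx.posDef
  obtain ⟨m, σ, τ, h⟩ := Lasso.exists_isKnotSequence hK (Lasso.covVector x y)
  refine ⟨fun γ => Lasso.isLeastSquares_iff_eq_center hx, -‖Lasso.covVector x y‖,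
    Lasso.lassoPath x y, fun s hs γ => Lasso.isLassoSolutionAt_iff_eq_lassoPath hx hs,
    Lasso.strictMonoOn_l1_path hK, Lasso.image_l1_path hK,
    fun s hs γ => Lasso.isLassoSolution_iff_eq_lassoPath hx hs.2,
    m, σ, Lasso.lassoPath x y ∘ σ, h.strictAnti, h.zero, h.last, fun i => rfl, ?_, ?_,
    h.isSimple hK, h.image_path hK, h.noParallel hK, fun i => ?_⟩
  · rw [Function.comp_apply, h.zero, Lasso.lassoPath_zero hx]
  · rw [Function.comp_apply, h.last]
    exact Lasso.path_neg_norm hK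
  · exact ⟨Lasso.face (τ i), Lasso.faceSign (τ i), Lasso.face_nonempty (h.ne_zero hK i),
      Lasso.faceSign_eq_one_or_eq_neg_one, h.edge_subset_ray hx i, h.eqOn_lassoPath hx i,
      fun s hs j => h.faceSign_mul_path_pos hs j⟩

theorem mainTheorem1 {N p : ℕ} (x : Fin N → Fin p → ℝ) (y : Fin N → ℝ)
    (hx : Lasso.FullRank x) :
    (∀ γ : Fin p → ℝ, Lasso.IsLeastSquares x y γ ↔ γ = Lasso.center x y) ∧
    ∃ (s' : ℝ) (β : ℝ → Fin p → ℝ),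
      -- `β s` is the unique lasso solution with parameter `s`
      (∀ s ∈ Set.Ioc s' 0, ∀ γ : Fin p → ℝ, Lasso.IsLassoSolutionAt x y s γ ↔ γ = β s) ∧
      -- equivalently, with `t = ‖β s‖₁`, it is the unique lasso solution with constraint `t`
      StrictMonoOn (fun s => Lasso.l1 (β s)) (Set.Icc s' 0) ∧
      (fun s => Lasso.l1 (β s)) '' Set.Icc s' 0 = Set.Icc 0 (Lasso.l1 (Lasso.center x y)) ∧
      (∀ s ∈ Set.Icc s' 0, ∀ γ : Fin p → ℝ,
        Lasso.IsLassoSolution x y (Lasso.l1 (β s)) γ ↔ γ = β s) ∧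
      -- the path is a simple polygonal chain from the center to the origin
      ∃ (m : ℕ) (σ : Fin (m + 1) → ℝ) (v : Fin (m + 1) → Fin p → ℝ),
        StrictAnti σ ∧ σ 0 = 0 ∧ σ (Fin.last m) = s' ∧
        (∀ i, v i = β (σ i)) ∧
        v 0 = Lasso.center x y ∧ v (Fin.last m) = 0 ∧
        PolygonalChain.IsSimple v ∧
        β '' Set.Icc s' 0 = PolygonalChain.trace v ∧
        PolygonalChain.NoParallel v ∧
        -- every segment lies on a ray of the original problem or of an induced problem
        ∀ i : Fin m, ∃ (A : Finset (Fin p)) (δ : A → ℝ),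
          A.Nonempty ∧ (∀ j, δ j = 1 ∨ δ j = -1) ∧
          PolygonalChain.edge v i ⊆
            Lasso.extendZero A '' Lasso.ray (Lasso.induced x A) y δ ∧
          (∀ s ∈ Set.Icc (σ i.succ) (σ i.castSucc),
            β s = Lasso.extendZero A (Lasso.rayPoint (Lasso.induced x A) y δ s)) ∧
          (∀ s ∈ Set.Ioo (σ i.succ) (σ i.castSucc), ∀ j : A, 0 < δ j * β s j) :=
  mainTheorem1_general x y hx
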